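/- Let $\Bbbk$ be a commutative ring and let $R$ be an associative $\Bbbk$-algebra. $R$-modules are left modules, $R^\circ$-modules are right $R$-modules, and functors go from $R$-modules to $\Bbbk$-modules. An acyclic complex $T$ of projective $R^\circ$-modules is totally acyclic if $\operatorname{Hom}_{R^\circ}(T,P)$ is acyclic for every projective $R^\circ$-module $P$. An $R^\circ$-module $G$ is Gorenstein projective if $G\cong\operatorname{Coker}(T_1\to T_0)$ for some totally acyclic complex $T$ of projective $R^\circ$-modules. It is Gorenstein flat if $G\cong\operatorname{Coker}(F_1\to F_0)$ for some acyclic complex $F$ of flat $R^\circ$-modules such that $F\otimes_R E$ is acyclic for every injective $R$-module $E$. A complete projective resolution of an $R^\circ$-module $M$ is a diagram $T\xrightarrow{\varpi}P\xrightarrow{\simeq}M$, where $T$ is a totally acyclic complex of projective $R^\circ$-modules, $P\to M$ is a projective resolution, and $\varpi_i$ is an isomorphism for all $i\gg0$; the Tate homology of $M$ computed from it is $\widehat{\operatorname{Tor}}_i(M,N)=H_i(T\otimes_R N)$ for $i\in\mathbb Z$. For an $R^\circ$-module $M$, complete homology is the family of functors $$\widecheck{\operatorname{Tor}}_i(M,N)=\lim_{k\ge0}\,S^k\operatorname{Tor}_{k+i}(M,-)(N),\qquad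 i\in\mathbb Z.$$ Here $N\to I$ is an injective resolution, $\Omega^kN=\operatorname{Ker}(I^k\to I^{k+1})$, and for a functor $F$ the right satellites are $S^0F=F$ and $S^kF(N)=\operatorname{Coker}(F(I^{k-1})\to F(\Omega^kN))$ for $k\ge1$. The map $S^k\operatorname{Tor}_{k+i}(M,-)(N)\to S^{k-1}\operatorname{Tor}_{k-1+i}(M,-)(N)$ in the inverse system is induced by the connecting homomorphism $\operatorname{Tor}_{k+i}(M,\Omega^kN)\to\operatorname{Tor}_{k-1+i}(M,\Omega^{k-1}N)$ of the exact sequence $0\to\Omega^{k-1}N\to I^{k-1}\to\Omega^kN\to0$. The following conditions on $R$ are equivalent. (i) Every Gorenstein projective $R^\circ$-module is Gorenstein flat. (ii) For every $R^\circ$-module $M$, every complete projective resolution $T\to P\to M$, and every $i\in\mathbb Z$, there is an isomorphism of functors on the category of $R$-modules $$\widecheck{\operatorname{Tor}}_i(M,-)\;\cong\;\widehat{\operatorname{Tor}}_i(M,-)=H_i(T\otimes_R-).$$ -/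

import Mathlib

open CategoryTheory CategoryTheory.Limits
open scoped TensorProduct

universe u

namespace CompleteHomology

noncomputable section

/-! ## The tensor product over a noncommutative algebra

`R` is an associative algebra over a commutative ring `𝕜`.  Left `R`-modules are objects of
`ModuleCat R`, right `R`-modules are objects of `ModuleCat Rᵐᵒᵖ`. -/

/-- The `𝕜`-submodule of `M ⊗[𝕜] N` generated by the elements `m r ⊗ n - m ⊗ r n`. -/
def balancedRel (𝕜 : Type u) [CommRing 𝕜] (R : Type u) [Ring R]
    (M N : Type u) [AddCommGroup M] [AddCommGroup N] [Module 𝕜 M] [Module 𝕜 N]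
    [Module Rᵐᵒᵖ M] [Module R N] : Submodule 𝕜 (M ⊗[𝕜] N) :=
  Submodule.span 𝕜 {x | ∃ (m : M) (r : R) (n : N),
    x = (MulOpposite.op r • m) ⊗ₜ[𝕜] n - m ⊗ₜ[𝕜] (r • n)}

/-- The tensor product `M ⊗_R N` of a right `R`-module `M` and a left `R`-module `N`, as a
`𝕜`-module. -/
abbrev BalTensor (𝕜 : Type u) [CommRing 𝕜] (R : Type u) [Ring R]
    (M N : Type u) [AddCommGroup M] [AddCommGroup N] [Module 𝕜 M] [Module 𝕜 N]
    [Module Rᵐᵒᵖ M] [Module R N] : Type u :=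
  (M ⊗[𝕜] N) ⧸ balancedRel 𝕜 R M N

/-- A module over a `𝕜`-algebra is a `𝕜`-module. -/
@[reducible]
def baseModule (𝕜 : Type u) [CommRing 𝕜] {A : Type u} [Ring A] [Algebra 𝕜 A]
    (M : ModuleCat.{u} A) : Module 𝕜 M :=
  Module.compHom M (algebraMap 𝕜 A)

attribute [local instance] baseModule

/-- A morphism of modules over a `𝕜`-algebra, viewed as a `𝕜`-linear map. -/
def baseMap (𝕜 : Type u) [CommRing 𝕜] {A : Type u} [Ring A] [Algebra 𝕜 A]
    {M M' : ModuleCat.{u} A} (f : M ⟶ M') : M →ₗ[𝕜] M' where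
  toFun := f
  map_add' := map_add f.hom
  map_smul' c x := map_smul f.hom (algebraMap 𝕜 A c) x

section Tensor

variable (𝕜 : Type u) [CommRing 𝕜] (R : Type u) [Ring R] [Algebra 𝕜 R]

/-- The map `f ⊗ g : M ⊗_R N → M' ⊗_R N'`. -/
def tensorMap {M M' : ModuleCat.{u} Rᵐᵒᵖ} {N N' : ModuleCat.{u} R} (f : M ⟶ M') (g : N ⟶ N') :
    BalTensor 𝕜 R M N →ₗ[𝕜] BalTensor 𝕜 R M' N' :=
  Submodule.mapQ _ _ (TensorProduct.map (baseMap 𝕜 f) (baseMap 𝕜 g)) (by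
    rw [balancedRel, Submodule.span_le]
    rintro _ ⟨m, r, n, rfl⟩
    refine Submodule.subset_span ⟨f m, r, g n, ?_⟩
    simp [baseMap, TensorProduct.map_tmul])

/-- The class of `m ⊗ n` in `M ⊗_R N`. -/
def tmk {M : ModuleCat.{u} Rᵐᵒᵖ} {N : ModuleCat.{u} R} (m : M) (n : N) : BalTensor 𝕜 R M N :=
  Submodule.Quotient.mk (m ⊗ₜ[𝕜] n)

@[simp]
theorem tensorMap_tmk {M M' : ModuleCat.{u} Rᵐᵒᵖ} {N N' : ModuleCat.{u} R}
    (f : M ⟶ M') (g : N ⟶ N') (m : M) (n : N) :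
    tensorMap 𝕜 R f g (tmk 𝕜 R m n) = tmk 𝕜 R (f m) (g n) := rfl

theorem tmk_smul {M : ModuleCat.{u} Rᵐᵒᵖ} {N : ModuleCat.{u} R} (m : M) (r : R) (n : N) :
    tmk 𝕜 R (MulOpposite.op r • m) n = tmk 𝕜 R m (r • n) :=
  (Submodule.Quotient.eq _).2 (Submodule.subset_span ⟨m, r, n, rfl⟩)

theorem tmk_add_left {M : ModuleCat.{u} Rᵐᵒᵖ} {N : ModuleCat.{u} R} (m m' : M) (n : N) :
    tmk 𝕜 R (m + m') n = tmk 𝕜 R m n + tmk 𝕜 R m' n := by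
  simp [tmk, TensorProduct.add_tmul]

theorem tmk_add_right {M : ModuleCat.{u} Rᵐᵒᵖ} {N : ModuleCat.{u} R} (m : M) (n n' : N) :
    tmk 𝕜 R m (n + n') = tmk 𝕜 R m n + tmk 𝕜 R m n' := by
  simp [tmk, TensorProduct.tmul_add]

variable {𝕜 R} in
theorem balTensor_hom_ext {M : ModuleCat.{u} Rᵐᵒᵖ} {N : ModuleCat.{u} R} {X : Type u}
    [AddCommGroup X] [Module 𝕜 X] {f g : BalTensor 𝕜 R M N →ₗ[𝕜] X}
    (h : ∀ m n, f (tmk 𝕜 R m n) = g (tmk 𝕜 R m n)) : f = g := by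
  refine Submodule.linearMap_qext _ (TensorProduct.ext' fun m n => h m n)

/-- The tensor product `M ⊗_R N` as a functor of both arguments. -/
def tensor : ModuleCat.{u} Rᵐᵒᵖ ⥤ ModuleCat.{u} R ⥤ ModuleCat.{u} 𝕜 where
  obj M :=
    { obj N := ModuleCat.of 𝕜 (BalTensor 𝕜 R M N)
      map g := ModuleCat.ofHom (tensorMap 𝕜 R (𝟙 M) g)
      map_id N := by
        apply ModuleCat.hom_ext
        exact balTensor_hom_ext fun m n => rfl
      map_comp f g := by
        apply ModuleCat.hom_ext
        exact balTensor_hom_ext fun m n => rfl }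
  map f :=
    { app N := ModuleCat.ofHom (tensorMap 𝕜 R f (𝟙 N))
      naturality _ _ g := by
        apply ModuleCat.hom_ext
        exact balTensor_hom_ext fun m n => rfl }
  map_id M := by
    ext N : 2
    apply ModuleCat.hom_ext
    exact balTensor_hom_ext fun m n => rfl
  map_comp f g := by
    ext N : 2
    apply ModuleCat.hom_ext
    exact balTensor_hom_ext fun m n => rfl

instance tensor_obj_additive (M : ModuleCat.{u} Rᵐᵒᵖ) : ((tensor 𝕜 R).obj M).Additive where
  map_add {N N' f g} := by
    apply ModuleCat.hom_ext
    exact balTensor_hom_ext fun m n => tmk_add_right 𝕜 R m (f n) (g n)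

instance tensor_flip_obj_additive (N : ModuleCat.{u} R) :
    ((tensor 𝕜 R).flip.obj N).Additive where
  map_add {M M' f g} := by
    apply ModuleCat.hom_ext
    exact balTensor_hom_ext fun m n => tmk_add_left 𝕜 R (f m) (g m) n

/-- For a complex `X` of right `R`-modules, the functor `N ↦ X ⊗_R N`, with values in complexes
of `𝕜`-modules. -/
def tensorComplex (X : ChainComplex (ModuleCat.{u} Rᵐᵒᵖ) ℤ) :
    ModuleCat.{u} R ⥤ ChainComplex (ModuleCat.{u} 𝕜) ℤ where
  obj N := (((tensor 𝕜 R).flip.obj N).mapHomologicalComplex _).obj X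
  map f := (NatTrans.mapHomologicalComplex ((tensor 𝕜 R).flip.map f) _).app X

instance tensorComplex_additive (X : ChainComplex (ModuleCat.{u} Rᵐᵒᵖ) ℤ) :
    (tensorComplex 𝕜 R X).Additive where
  map_add {N N' f g} := by
    ext n : 1
    exact ((tensor 𝕜 R).obj (X.X n)).map_add

/-- A right `R`-module `F` is flat if `F ⊗_R -` preserves injective maps. -/
def IsFlat (F : ModuleCat.{u} Rᵐᵒᵖ) : Prop :=
  ∀ ⦃N N' : ModuleCat.{u} R⦄ (f : N ⟶ N'), Mono f → Mono (((tensor 𝕜 R).obj F).map f)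

end Tensor

/-! ## Homological functors and their completion -/

section Completion

variable (𝕜 : Type u) [CommRing 𝕜] (R : Type u) [Ring R]

/-- A homological functor from left `R`-modules to `𝕜`-modules: a family of additive functors
with natural connecting homomorphisms and long exact sequences. -/
structure HomologicalFunctor where
  T : ℤ → (ModuleCat.{u} R ⥤ ModuleCat.{u} 𝕜)
  additive (i : ℤ) : (T i).Additive
  δ {S : ShortComplex (ModuleCat.{u} R)} (hS : S.ShortExact) (i j : ℤ) (hij : j + 1 = i) :
    (T i).obj S.X₃ ⟶ (T j).obj S.X₁
  δ_naturality {S S' : ShortComplex (ModuleCat.{u} R)} (hS : S.ShortExact) (hS' : S'.ShortExact)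
    (φ : S ⟶ S') (i j : ℤ) (hij : j + 1 = i) :
    (T i).map φ.τ₃ ≫ δ hS' i j hij = δ hS i j hij ≫ (T j).map φ.τ₁
  exact₁ {S : ShortComplex (ModuleCat.{u} R)} (hS : S.ShortExact) (i j : ℤ) (hij : j + 1 = i) :
    Function.Exact (δ hS i j hij) ((T j).map S.f)
  exact₂ {S : ShortComplex (ModuleCat.{u} R)} (_ : S.ShortExact) (i : ℤ) :
    Function.Exact ((T i).map S.f) ((T i).map S.g)
  exact₃ {S : ShortComplex (ModuleCat.{u} R)} (hS : S.ShortExact) (i j : ℤ) (hij : j + 1 = i) :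
    Function.Exact ((T i).map S.g) (δ hS i j hij)

/-- A functorial factorization of every morphism of left `R`-modules into a monomorphism followed
by a morphism with the right lifting property against monomorphisms. -/
def factData : MorphismProperty.FunctorialFactorizationData
    (MorphismProperty.monomorphisms (ModuleCat.{u} R))
    (MorphismProperty.monomorphisms (ModuleCat.{u} R)).rlp :=
  MorphismProperty.functorialFactorizationData _ _

/-- The functor sending `N` to the arrow `N ⟶ 0`. -/
def toZeroArrow : ModuleCat.{u} R ⥤ Arrow (ModuleCat.{u} R) where
  obj N := Arrow.mk (0 : N ⟶ (ModuleCat.of R PUnit.{u + 1}))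
  map f := Arrow.homMk f (𝟙 _) (by simp)
  map_id N := by ext <;> rfl
  map_comp f g := by
    apply Arrow.hom_ext
    · rfl
    · exact (Category.comp_id _).symm

/-- A functor that sends a left `R`-module `N` to an injective module containing it. -/
def inj : ModuleCat.{u} R ⥤ ModuleCat.{u} R := toZeroArrow R ⋙ (factData R).Z

/-- The natural embedding of `N` into the injective module `inj N`. -/
def ι : 𝟭 (ModuleCat.{u} R) ⟶ inj R where
  app N := (factData R).i.app ((toZeroArrow R).obj N)
  naturality _ _ f := (factData R).i.naturality ((toZeroArrow R).map f)

instance mono_ι (N : ModuleCat.{u} R) : Mono ((ι R).app N) :=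
  (factData R).hi ((toZeroArrow R).obj N)

instance injective_inj (N : ModuleCat.{u} R) : Injective ((inj R).obj N) where
  factors {X Y} g f hf := by
    have h := (factData R).hp ((toZeroArrow R).obj N) f hf
    have sq : CommSq g f ((factData R).p.app ((toZeroArrow R).obj N))
        (0 : Y ⟶ (ModuleCat.of R PUnit.{u + 1})) :=
      ⟨by ext; exact Subsingleton.elim (α := PUnit) _ _⟩
    have : sq.HasLift := h.sq_hasLift sq
    exact ⟨sq.lift, sq.fac_left⟩

/-- The first cosyzygy functor `N ↦ inj N / N`. -/
def Ω : ModuleCat.{u} R ⥤ ModuleCat.{u} R where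
  obj N := cokernel ((ι R).app N)
  map {N N'} f := cokernel.map _ _ f ((inj R).map f) ((ι R).naturality f).symm
  map_id N := by
    rw [← cancel_epi (cokernel.π ((ι R).app N))]
    simp
  map_comp f g := by
    rw [← cancel_epi (cokernel.π ((ι R).app _))]
    simp

/-- The functorial short exact sequence `0 → N → inj N → Ω N → 0`. -/
def cosyzygySeq : ModuleCat.{u} R ⥤ ShortComplex (ModuleCat.{u} R) where
  obj N := ShortComplex.mk ((ι R).app N) (cokernel.π ((ι R).app N)) (cokernel.condition _)
  map {N N'} f :=
    { τ₁ := f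
      τ₂ := (inj R).map f
      τ₃ := (Ω R).map f
      comm₁₂ := (ι R).naturality f
      comm₂₃ := by simp [Ω] }

theorem cosyzygySeq_shortExact (N : ModuleCat.{u} R) : ((cosyzygySeq R).obj N).ShortExact where
  exact := ShortComplex.exact_cokernel ((ι R).app N)
  mono_f := mono_ι R N
  epi_g := by dsimp [cosyzygySeq]; infer_instance

/-- The `k`-th cosyzygy functor `Ωᵏ`; the modules `inj (Ωᵏ N)` are the terms `Iᵏ` of an injective
resolution `I` of `N`, and `Ωᵏ N = Ker (Iᵏ → Iᵏ⁺¹)`. -/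
def Ωpow : ℕ → (ModuleCat.{u} R ⥤ ModuleCat.{u} R)
  | 0 => 𝟭 _
  | k + 1 => Ωpow k ⋙ Ω R

/-- The projection `inj N ⟶ Ω N`, natural in `N`. -/
def injToΩ : inj R ⟶ Ω R where
  app N := cokernel.π ((ι R).app N)
  naturality _ _ f := by simp [Ω]

variable {𝕜 R}

/-- The `k`-th right satellite `Sᵏ F` of a functor `F`: it sends `N` to the cokernel of
`F (Iᵏ⁻¹) → F (Ωᵏ N)`, where `I⁻¹ = 0`. -/
def satellite (F : ModuleCat.{u} R ⥤ ModuleCat.{u} 𝕜) : ℕ → (ModuleCat.{u} R ⥤ ModuleCat.{u} 𝕜)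
  | 0 => F
  | k + 1 => cokernel (Functor.whiskerRight (Functor.whiskerLeft (Ωpow R k) (injToΩ R)) F)

/-- The canonical projection `F (Ωᵏ N) → Sᵏ F (N)`. -/
def satelliteProj (F : ModuleCat.{u} R ⥤ ModuleCat.{u} 𝕜) :
    (k : ℕ) → (Ωpow R k ⋙ F ⟶ satellite F k)
  | 0 => (Functor.leftUnitor F).hom
  | _ + 1 => cokernel.π _

namespace HomologicalFunctor

variable (H : HomologicalFunctor.{u} 𝕜 R)

/-- The connecting map `T_i (Ωᵏ⁺¹ N) ⟶ T_j (Ωᵏ N)`, where `i = j + 1`, natural in `N`. -/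
def connecting (k : ℕ) (i j : ℤ) (hij : j + 1 = i) :
    (Ωpow R k ⋙ Ω R) ⋙ H.T i ⟶ Ωpow R k ⋙ H.T j where
  app N := H.δ (cosyzygySeq_shortExact R ((Ωpow R k).obj N)) i j hij
  naturality _ _ f := H.δ_naturality _ _ ((cosyzygySeq R).map ((Ωpow R k).map f)) i j hij

theorem injToΩ_connecting (k : ℕ) (i j : ℤ) (hij : j + 1 = i) :
    Functor.whiskerRight (Functor.whiskerLeft (Ωpow R k) (injToΩ R)) (H.T i) ≫
      H.connecting k i j hij = 0 := by
  ext N x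
  exact (H.exact₃ (cosyzygySeq_shortExact R ((Ωpow R k).obj N)) i j hij).apply_apply_eq_zero x

/-- The map `Sᵏ⁺¹ T_i (N) ⟶ Sᵏ T_j (N)`, where `i = j + 1`, induced by the connecting map
`T_i (Ωᵏ⁺¹ N) ⟶ T_j (Ωᵏ N)`. -/
def transition (k : ℕ) (i j : ℤ) (hij : j + 1 = i) :
    satellite (H.T i) (k + 1) ⟶ satellite (H.T j) k :=
  cokernel.desc _ (H.connecting k i j hij ≫ satelliteProj (H.T j) k) (by
    rw [← Category.assoc, injToΩ_connecting, zero_comp])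

/-- The `i`-th component of the injective completion of a homological functor,
`N ↦ lim_k Sᵏ T_{k+i} (N)`; the limit is taken along the maps `transition`. -/
def completion (i : ℤ) : ModuleCat.{u} R ⥤ ModuleCat.{u} 𝕜 :=
  limit (Functor.ofOpSequence (X := fun k : ℕ => satellite (H.T (k + i)) k)
    (fun k => H.transition k (((k + 1 : ℕ) : ℤ) + i) (k + i) (by push_cast; ring)))

end HomologicalFunctor

end Completion

/-! ## Tor and complete homology -/

/-- The inclusion of the nonnegative degrees into all degrees. -/
def natEmbedding : (ComplexShape.down ℕ).Embedding (ComplexShape.down ℤ) :=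
  ComplexShape.Embedding.mk' _ _ (fun n => (n : ℤ)) (fun _ _ h => by simpa using h)
    (by intro i j; simp only [ComplexShape.down_Rel]; omega)

section Tor

variable {R : Type u} [Ring R]

/-- The complex underlying a projective resolution, with zeros in negative degrees. -/
abbrev resolutionComplex {M : ModuleCat.{u} Rᵐᵒᵖ} (P : ProjectiveResolution M) :
    ChainComplex (ModuleCat.{u} Rᵐᵒᵖ) ℤ :=
  P.complex.extend natEmbedding

theorem resolutionComplex_projective {M : ModuleCat.{u} Rᵐᵒᵖ} (P : ProjectiveResolution M)
    (n : ℤ) : Projective ((resolutionComplex P).X n) := by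
  by_cases h : ∃ i, natEmbedding.f i = n
  · obtain ⟨i, hi⟩ := h
    exact Projective.of_iso (P.complex.extendXIso natEmbedding hi).symm (P.projective i)
  · exact (P.complex.isZero_extend_X natEmbedding n (by simpa using h)).projective

variable (𝕜 : Type u) [CommRing 𝕜] [Algebra 𝕜 R]

/-- For a linear form `c` on a right module `M`, the map `M ⊗_R N → N`, `m ⊗ n ↦ c(m) n`. -/
def evalForm {M : ModuleCat.{u} Rᵐᵒᵖ} (c : M →ₗ[Rᵐᵒᵖ] Rᵐᵒᵖ) (N : ModuleCat.{u} R) :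
    BalTensor 𝕜 R M N →ₗ[𝕜] N :=
  Submodule.liftQ _ (TensorProduct.lift (LinearMap.mk₂ 𝕜
    (fun (m : M) (n : N) => (c m).unop • n)
    (fun m m' n => by simp [add_smul])
    (fun a m n => by
      change (c (algebraMap 𝕜 Rᵐᵒᵖ a • m)).unop • n = algebraMap 𝕜 R a • (c m).unop • n
      rw [map_smul, smul_eq_mul, MulOpposite.unop_mul, MulOpposite.algebraMap_apply,
        MulOpposite.unop_op, ← Algebra.commutes, mul_smul])
    (fun m n n' => smul_add _ _ _)
    (fun a m n => by
      change (c m).unop • algebraMap 𝕜 R a • n = algebraMap 𝕜 R a • (c m).unop • n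
      rw [← mul_smul, ← mul_smul, Algebra.commutes]))) (by
    rw [balancedRel, Submodule.span_le]
    rintro _ ⟨m, r, n, rfl⟩
    simp [mul_smul])

/-- Projective right modules are flat. -/
theorem isFlat_of_projective (F : ModuleCat.{u} Rᵐᵒᵖ) (hF : Projective F) : IsFlat 𝕜 R F := by
  intro N N' f hf
  rw [ModuleCat.mono_iff_injective] at hf ⊢
  have : Module.Projective Rᵐᵒᵖ F := (IsProjective.iff_projective (R := Rᵐᵒᵖ) F).2 hF
  obtain ⟨s, hs⟩ := Module.Projective.out (R := Rᵐᵒᵖ) (P := F)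
  let c (x : F) : F →ₗ[Rᵐᵒᵖ] Rᵐᵒᵖ := (Finsupp.lapply x).comp s
  have key (t : BalTensor 𝕜 R F N) : ∃ S : Finset F, ∀ S', S ⊆ S' →
      t = ∑ x ∈ S', tmk 𝕜 R x (evalForm 𝕜 (c x) N t) := by
    obtain ⟨t, rfl⟩ := Submodule.Quotient.mk_surjective _ t
    induction t with
    | zero => exact ⟨∅, fun S' _ => by simp [tmk]⟩
    | tmul m n =>
      refine ⟨(s m).support, fun S' hS => ?_⟩
      have h1 (x : F) : tmk 𝕜 R x (evalForm 𝕜 (c x) N (tmk 𝕜 R m n)) =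
          tmk 𝕜 R (s m x • x) n := (tmk_smul 𝕜 R x (s m x).unop n).symm
      change tmk 𝕜 R m n = ∑ x ∈ S', tmk 𝕜 R x (evalForm 𝕜 (c x) N (tmk 𝕜 R m n))
      simp only [h1]
      let L : F →+ BalTensor 𝕜 R F N := AddMonoidHom.mk' (fun m => tmk 𝕜 R m n)
        (fun a b => tmk_add_left 𝕜 R a b n)
      have h2 := hs m
      rw [Finsupp.linearCombination_apply, Finsupp.sum_of_support_subset _ hS _ (by simp)] at h2
      calc tmk 𝕜 R m n = L (∑ x ∈ S', s m x • x) := congrArg L h2.symm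
        _ = _ := map_sum L _ _
    | add a b ha hb =>
      classical
      obtain ⟨S, hS⟩ := ha
      obtain ⟨S₂, hS₂⟩ := hb
      refine ⟨S ∪ S₂, fun S' h => ?_⟩
      have e1 := hS S' (Finset.union_subset_left h)
      have e2 := hS₂ S' (Finset.union_subset_right h)
      simp only [Submodule.Quotient.mk_add, map_add, tmk_add_right, Finset.sum_add_distrib]
      rw [← e1, ← e2]
  have nat (x : F) (t : BalTensor 𝕜 R F N) :
      evalForm 𝕜 (c x) N' (tensorMap 𝕜 R (𝟙 F) f t) = f (evalForm 𝕜 (c x) N t) := by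
    have : (evalForm 𝕜 (c x) N').comp (tensorMap 𝕜 R (𝟙 F) f) =
        (baseMap 𝕜 f).comp (evalForm 𝕜 (c x) N) :=
      balTensor_hom_ext fun m n => (map_smul f.hom (c x m).unop n).symm
    exact congrArg (fun l => l t) this
  refine (injective_iff_map_eq_zero (tensorMap 𝕜 R (𝟙 F) f)).2 fun t ht => ?_
  obtain ⟨S, hS⟩ := key t
  rw [hS S subset_rfl]
  refine Finset.sum_eq_zero fun x _ => ?_
  have h0 : evalForm 𝕜 (c x) N t = 0 := hf (by rw [← nat, ht, map_zero, map_zero])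
  rw [h0]
  simp [tmk]

/-- Tensoring with a projective right module preserves short exact sequences. -/
theorem shortExact_tensor_of_projective (F : ModuleCat.{u} Rᵐᵒᵖ) (hF : Projective F)
    {S : ShortComplex (ModuleCat.{u} R)} (hS : S.ShortExact) :
    (S.map ((tensor 𝕜 R).obj F)).ShortExact := by
  have hg : Function.Surjective S.g := (ModuleCat.epi_iff_surjective _).1 hS.epi_g
  have hex : Function.Exact (baseMap 𝕜 S.f) (baseMap 𝕜 S.g) :=
    (ShortComplex.ShortExact.moduleCat_exact_iff_function_exact S).1 hS.exact
  refine { exact := ?_, mono_f := isFlat_of_projective 𝕜 F hF S.f hS.mono_f, epi_g := ?_ }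
  · rw [ShortComplex.moduleCat_exact_iff]
    intro t ht
    obtain ⟨t, rfl⟩ := Submodule.Quotient.mk_surjective _ t
    let G := (baseMap 𝕜 S.g).lTensor F
    have h1 : G t ∈ balancedRel 𝕜 R F S.X₃ := (Submodule.Quotient.mk_eq_zero _).1 ht
    have h2 : balancedRel 𝕜 R F S.X₃ ≤ (balancedRel 𝕜 R F S.X₂).map G := by
      rw [balancedRel, Submodule.span_le]
      rintro _ ⟨m, r, n, rfl⟩
      obtain ⟨n, rfl⟩ := hg n
      refine ⟨_, Submodule.subset_span ⟨m, r, n, rfl⟩, ?_⟩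
      simp [G, baseMap]
    obtain ⟨b, hb, hb'⟩ := h2 h1
    obtain ⟨y, hy⟩ := (lTensor_exact F hex hg (t - b)).1 (by rw [map_sub]; exact sub_eq_zero.2 hb'.symm)
    refine ⟨Submodule.Quotient.mk y, ?_⟩
    refine (Submodule.Quotient.eq _).2 ?_
    change (baseMap 𝕜 S.f).lTensor F y - t ∈ _
    rw [hy, sub_sub_cancel_left]
    exact neg_mem hb
  · rw [ModuleCat.epi_iff_surjective]
    intro t
    obtain ⟨t, rfl⟩ := Submodule.Quotient.mk_surjective _ t
    obtain ⟨y, rfl⟩ := LinearMap.lTensor_surjective F (g := baseMap 𝕜 S.g) hg t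
    exact ⟨Submodule.Quotient.mk y, rfl⟩

theorem shortExact_tensorComplex (X : ChainComplex (ModuleCat.{u} Rᵐᵒᵖ) ℤ)
    (hX : ∀ n, Projective (X.X n)) {S : ShortComplex (ModuleCat.{u} R)} (hS : S.ShortExact) :
    (S.map (tensorComplex 𝕜 R X)).ShortExact :=
  HomologicalComplex.shortExact_of_degreewise_shortExact _ fun n =>
    shortExact_tensor_of_projective 𝕜 (X.X n) (hX n) hS

/-- For a complex `X` of projective right `R`-modules, the functors `N ↦ H_i (X ⊗_R N)` form a
homological functor. -/
def homologyOfTensor (X : ChainComplex (ModuleCat.{u} Rᵐᵒᵖ) ℤ) (hX : ∀ n, Projective (X.X n)) :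
    HomologicalFunctor.{u} 𝕜 R where
  T i := tensorComplex 𝕜 R X ⋙ HomologicalComplex.homologyFunctor _ _ i
  additive _ := inferInstance
  δ hS i j hij := (shortExact_tensorComplex 𝕜 X hX hS).δ i j hij
  δ_naturality hS hS' φ i j hij :=
    (HomologicalComplex.HomologySequence.δ_naturality ((tensorComplex 𝕜 R X).mapShortComplex.map φ)
      (shortExact_tensorComplex 𝕜 X hX hS) (shortExact_tensorComplex 𝕜 X hX hS') i j hij).symm
  exact₁ hS i j hij := (ShortComplex.ShortExact.moduleCat_exact_iff_function_exact _).1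
    ((shortExact_tensorComplex 𝕜 X hX hS).homology_exact₁ i j hij)
  exact₂ hS i := (ShortComplex.ShortExact.moduleCat_exact_iff_function_exact _).1
    ((shortExact_tensorComplex 𝕜 X hX hS).homology_exact₂ i)
  exact₃ hS i j hij := (ShortComplex.ShortExact.moduleCat_exact_iff_function_exact _).1
    ((shortExact_tensorComplex 𝕜 X hX hS).homology_exact₃ i j hij)

/-- The homological functor `Tor (M, -)`, computed from a projective resolution of the right
`R`-module `M`. -/
def Tor (M : ModuleCat.{u} Rᵐᵒᵖ) : HomologicalFunctor.{u} 𝕜 R :=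
  homologyOfTensor 𝕜 (resolutionComplex (projectiveResolution M))
    (resolutionComplex_projective _)

/-- The complete homology functor `N ↦ Ťor_i (M, N) = lim_k Sᵏ Tor_{k+i} (M, -) (N)`. -/
def completeTor (M : ModuleCat.{u} Rᵐᵒᵖ) (i : ℤ) : ModuleCat.{u} R ⥤ ModuleCat.{u} 𝕜 :=
  (Tor 𝕜 M).completion i

end Tor

/-! ## Gorenstein modules and Tate homology -/

section Gorenstein

variable {R : Type u} [Ring R]

/-- A totally acyclic complex of projective right `R`-modules: an acyclic complex `T` of
projective modules such that `Hom (T, P)` is acyclic for every projective module `P`. -/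
structure IsTotallyAcyclic (T : ChainComplex (ModuleCat.{u} Rᵐᵒᵖ) ℤ) : Prop where
  projective (n : ℤ) : Projective (T.X n)
  acyclic : T.Acyclic
  hom_acyclic (P : ModuleCat.{u} Rᵐᵒᵖ) : Projective P →
    (((preadditiveYoneda.obj P).mapHomologicalComplex _).obj T.op).Acyclic

/-- A right `R`-module is Gorenstein projective if it is isomorphic to `Coker (T₁ → T₀)` for some
totally acyclic complex `T` of projective modules. -/
def IsGorensteinProjective (G : ModuleCat.{u} Rᵐᵒᵖ) : Prop :=
  ∃ T : ChainComplex (ModuleCat.{u} Rᵐᵒᵖ) ℤ, IsTotallyAcyclic T ∧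
    Nonempty (cokernel (T.d 1 0) ≅ G)

/-- A complete projective resolution `T ⟶ P ⟶ M` of a right `R`-module `M`. -/
structure CompleteProjectiveResolution (M : ModuleCat.{u} Rᵐᵒᵖ) where
  T : ChainComplex (ModuleCat.{u} Rᵐᵒᵖ) ℤ
  totallyAcyclic : IsTotallyAcyclic T
  P : ProjectiveResolution M
  ϖ : T ⟶ resolutionComplex P
  isIso_ϖ : ∃ n : ℤ, ∀ i ≥ n, IsIso (ϖ.f i)

variable (𝕜 : Type u) [CommRing 𝕜] [Algebra 𝕜 R]

/-- A right `R`-module is Gorenstein flat if it is isomorphic to `Coker (T₁ → T₀)` for some acyclic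
complex `T` of flat modules such that `T ⊗_R E` is acyclic for every injective left `R`-module
`E`. -/
def IsGorensteinFlat (G : ModuleCat.{u} Rᵐᵒᵖ) : Prop :=
  ∃ T : ChainComplex (ModuleCat.{u} Rᵐᵒᵖ) ℤ,
    (∀ n, IsFlat 𝕜 R (T.X n)) ∧ T.Acyclic ∧
    (∀ E : ModuleCat.{u} R, Injective E → ((tensorComplex 𝕜 R T).obj E).Acyclic) ∧
    Nonempty (cokernel (T.d 1 0) ≅ G)

/-- The Tate homology functor `N ↦ H_i (T ⊗_R N)` of a module with a complete projective resolution
`T ⟶ P ⟶ M`. -/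
def CompleteProjectiveResolution.tateTor {M : ModuleCat.{u} Rᵐᵒᵖ}
    (C : CompleteProjectiveResolution M) (i : ℤ) : ModuleCat.{u} R ⥤ ModuleCat.{u} 𝕜 :=
  tensorComplex 𝕜 R C.T ⋙ HomologicalComplex.homologyFunctor _ _ i

end Gorenstein

end

end CompleteHomology

/-! Both conditions amount to this: `T ⊗_R E` is acyclic for every totally acyclic `T` and every
injective `E`.

Assume (i). For a short exact sequence `0 → L → Q → E → 0` with `Q` projective, the kernel of `G ⊗ L
→ G ⊗ Q` is `Tor₁(G, E)`, which does not depend on how `G` is resolved.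
`tensorMap_injective_of_exact` makes it vanish using a complex of flat modules that witnesses
Gorenstein flatness of `G`; `exact_tensorMap_of_injective` converts this into exactness of `T ⊗ E`.
All cokernels of `T` are Gorenstein projective, so every degree is covered. Tate homology thus
vanishes on injectives and satisfies dimension shifting (`nonempty_ΩpowIso`). In high degrees it
equals `Tor`, so the inverse system defining complete homology becomes constant, with value
`Tor_{k+i}(M, Ωᵏ N)` (`nonempty_completionIso`), and this shifts back to Tate homology in degree
`i`.

Assume (ii). Positive satellites vanish on injectives, hence so does any completion
(`completion_isZero`). A totally acyclic `T` gives a complete resolution of its own cokernel, so `T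
⊗ E` is acyclic and `T` itself witnesses Gorenstein flatness. -/

namespace CompleteHomology

noncomputable section

attribute [local instance] baseModule

/-! ### Exactness of the tensor product and vanishing of `Tor₁` -/

section TensorExact

variable (𝕜 : Type u) [CommRing 𝕜] {R : Type u} [Ring R] [Algebra 𝕜 R]

theorem tensorMap_comp_apply {M M' M'' : ModuleCat.{u} Rᵐᵒᵖ} {N N' N'' : ModuleCat.{u} R}
    (f : M ⟶ M') (f' : M' ⟶ M'') (g : N ⟶ N') (g' : N' ⟶ N'') (t : BalTensor 𝕜 R M N) :
    tensorMap 𝕜 R f' g' (tensorMap 𝕜 R f g t) = tensorMap 𝕜 R (f ≫ f') (g ≫ g') t := by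
  have : (tensorMap 𝕜 R f' g').comp (tensorMap 𝕜 R f g) = tensorMap 𝕜 R (f ≫ f') (g ≫ g') :=
    balTensor_hom_ext fun m n => rfl
  exact congrArg (fun l => l t) this

theorem tensorMap_comm {M M' : ModuleCat.{u} Rᵐᵒᵖ} {N N' : ModuleCat.{u} R}
    (f : M ⟶ M') (g : N ⟶ N') (t : BalTensor 𝕜 R M N) :
    tensorMap 𝕜 R f (𝟙 N') (tensorMap 𝕜 R (𝟙 M) g t) =
      tensorMap 𝕜 R (𝟙 M') g (tensorMap 𝕜 R f (𝟙 N) t) := by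
  simp [tensorMap_comp_apply]

theorem tensorMap_zero_left {M M' : ModuleCat.{u} Rᵐᵒᵖ} {N N' : ModuleCat.{u} R}
    (g : N ⟶ N') (t : BalTensor 𝕜 R M N) : tensorMap 𝕜 R (0 : M ⟶ M') g t = 0 := by
  have : tensorMap 𝕜 R (0 : M ⟶ M') g = 0 :=
    balTensor_hom_ext fun m n => by
      change tmk 𝕜 R (0 : M') (g n) = 0
      simp [tmk]
  exact congrArg (fun l => l t) this

theorem tensorMap_zero_right {M M' : ModuleCat.{u} Rᵐᵒᵖ} {N N' : ModuleCat.{u} R}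
    (f : M ⟶ M') (t : BalTensor 𝕜 R M N) : tensorMap 𝕜 R f (0 : N ⟶ N') t = 0 := by
  have : tensorMap 𝕜 R f (0 : N ⟶ N') = 0 :=
    balTensor_hom_ext fun m n => by
      change tmk 𝕜 R (f m) (0 : N') = 0
      simp [tmk]
  exact congrArg (fun l => l t) this

theorem tensorMap_surjective {M M' : ModuleCat.{u} Rᵐᵒᵖ} {N N' : ModuleCat.{u} R}
    {f : M ⟶ M'} {g : N ⟶ N'} (hf : Function.Surjective f) (hg : Function.Surjective g) :
    Function.Surjective (tensorMap 𝕜 R f g) := by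
  intro t
  obtain ⟨t, rfl⟩ := Submodule.Quotient.mk_surjective _ t
  obtain ⟨y, rfl⟩ := TensorProduct.map_surjective (g := baseMap 𝕜 f) (g' := baseMap 𝕜 g) hf hg t
  exact ⟨Submodule.Quotient.mk y, rfl⟩

/-- The functor `M ⊗_R -` is right exact. -/
theorem exact_tensorMap_right (M : ModuleCat.{u} Rᵐᵒᵖ) {A B C : ModuleCat.{u} R}
    {f : A ⟶ B} {g : B ⟶ C} (hex : Function.Exact f g) (hg : Function.Surjective g) :
    Function.Exact (tensorMap 𝕜 R (𝟙 M) f) (tensorMap 𝕜 R (𝟙 M) g) := by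
  intro t
  constructor
  · intro ht
    obtain ⟨t, rfl⟩ := Submodule.Quotient.mk_surjective _ t
    let G := (baseMap 𝕜 g).lTensor M
    have h1 : G t ∈ balancedRel 𝕜 R M C := (Submodule.Quotient.mk_eq_zero _).1 ht
    -- Balancing relations lift along the surjection `g`. Subtracting a lifted relation `b` from `t`
    -- gives an element killed already over `𝕜`, where right exactness is known.
    have h2 : balancedRel 𝕜 R M C ≤ (balancedRel 𝕜 R M B).map G := by
      rw [balancedRel, Submodule.span_le]
      rintro _ ⟨m, r, n, rfl⟩
      obtain ⟨n, rfl⟩ := hg n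
      refine ⟨_, Submodule.subset_span ⟨m, r, n, rfl⟩, ?_⟩
      simp [G, baseMap]
    obtain ⟨b, hb, hb'⟩ := h2 h1
    obtain ⟨y, hy⟩ := (lTensor_exact M (f := baseMap 𝕜 f) (g := baseMap 𝕜 g) hex hg (t - b)).1
      (by rw [map_sub]; exact sub_eq_zero.2 hb'.symm)
    refine ⟨Submodule.Quotient.mk y, ?_⟩
    refine (Submodule.Quotient.eq _).2 ?_
    change (baseMap 𝕜 f).lTensor M y - t ∈ _
    rw [hy, sub_sub_cancel_left]
    exact neg_mem hb
  · rintro ⟨y, rfl⟩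
    have h0 : f ≫ g = 0 := by ext x; exact hex.apply_apply_eq_zero x
    rw [tensorMap_comp_apply, h0, tensorMap_zero_right]

/-- The functor `- ⊗_R N` is right exact. -/
theorem exact_tensorMap_left {A B C : ModuleCat.{u} Rᵐᵒᵖ} (N : ModuleCat.{u} R)
    {f : A ⟶ B} {g : B ⟶ C} (hex : Function.Exact f g) (hg : Function.Surjective g) :
    Function.Exact (tensorMap 𝕜 R f (𝟙 N)) (tensorMap 𝕜 R g (𝟙 N)) := by
  intro t
  constructor
  · intro ht
    obtain ⟨t, rfl⟩ := Submodule.Quotient.mk_surjective _ t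
    let G := (baseMap 𝕜 g).rTensor N
    have h1 : G t ∈ balancedRel 𝕜 R C N := (Submodule.Quotient.mk_eq_zero _).1 ht
    have h2 : balancedRel 𝕜 R C N ≤ (balancedRel 𝕜 R B N).map G := by
      rw [balancedRel, Submodule.span_le]
      rintro _ ⟨m, r, n, rfl⟩
      obtain ⟨m, rfl⟩ := hg m
      refine ⟨_, Submodule.subset_span ⟨m, r, n, rfl⟩, ?_⟩
      simp [G, baseMap]
    obtain ⟨b, hb, hb'⟩ := h2 h1
    obtain ⟨y, hy⟩ := (rTensor_exact N (f := baseMap 𝕜 f) (g := baseMap 𝕜 g) hex hg (t - b)).1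
      (by rw [map_sub]; exact sub_eq_zero.2 hb'.symm)
    refine ⟨Submodule.Quotient.mk y, ?_⟩
    refine (Submodule.Quotient.eq _).2 ?_
    change (baseMap 𝕜 f).rTensor N y - t ∈ _
    rw [hy, sub_sub_cancel_left]
    exact neg_mem hb
  · rintro ⟨y, rfl⟩
    have h0 : f ≫ g = 0 := by ext x; exact hex.apply_apply_eq_zero x
    rw [tensorMap_comp_apply, h0, tensorMap_zero_left]

/-- For a linear form `c` on a left module `N`, the map `M ⊗_R N → M`, `m ⊗ n ↦ m c(n)`. -/
def evalFormRight {N : ModuleCat.{u} R} (c : N →ₗ[R] R) (M : ModuleCat.{u} Rᵐᵒᵖ) :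
    BalTensor 𝕜 R M N →ₗ[𝕜] M :=
  Submodule.liftQ _ (TensorProduct.lift (LinearMap.mk₂ 𝕜
    (fun (m : M) (n : N) => MulOpposite.op (c n) • m)
    (fun m m' n => smul_add _ _ _)
    (fun a m n => by
      change MulOpposite.op (c n) • algebraMap 𝕜 Rᵐᵒᵖ a • m =
        algebraMap 𝕜 Rᵐᵒᵖ a • MulOpposite.op (c n) • m
      rw [← mul_smul, ← mul_smul, Algebra.commutes])
    (fun m n n' => by simp [add_smul])
    (fun a m n => by
      change MulOpposite.op (c (algebraMap 𝕜 R a • n)) • m =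
        algebraMap 𝕜 Rᵐᵒᵖ a • MulOpposite.op (c n) • m
      rw [map_smul, smul_eq_mul, ← mul_smul, Algebra.commutes a (c n), MulOpposite.op_mul,
        MulOpposite.algebraMap_apply]))) (by
    rw [balancedRel, Submodule.span_le]
    rintro _ ⟨m, r, n, rfl⟩
    simp [mul_smul])

/-- Naturality in `M` lets exactness of `- ⊗ N`, for `N` projective, be checked one dual-basis
coordinate at a time. -/
theorem evalFormRight_tensorMap {N : ModuleCat.{u} R} (c : N →ₗ[R] R)
    {M M' : ModuleCat.{u} Rᵐᵒᵖ} (f : M ⟶ M') (t : BalTensor 𝕜 R M N) :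
    evalFormRight 𝕜 c M' (tensorMap 𝕜 R f (𝟙 N) t) = f (evalFormRight 𝕜 c M t) := by
  have : (evalFormRight 𝕜 c M').comp (tensorMap 𝕜 R f (𝟙 N)) =
      (baseMap 𝕜 f).comp (evalFormRight 𝕜 c M) :=
    balTensor_hom_ext fun m n => (map_smul f.hom (MulOpposite.op (c n)) m).symm
  exact congrArg (fun l => l t) this

/-- An element of `M ⊗_R N` with `N` projective is recovered from its coordinates in a dual
basis. -/
theorem eq_sum_evalFormRight {N : ModuleCat.{u} R} (s : N →ₗ[R] N →₀ R)
    (hs : Function.LeftInverse (Finsupp.linearCombination R id) s)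
    (M : ModuleCat.{u} Rᵐᵒᵖ) (t : BalTensor 𝕜 R M N) :
    ∃ S : Finset N, ∀ S', S ⊆ S' →
      t = ∑ x ∈ S', tmk 𝕜 R (evalFormRight 𝕜 ((Finsupp.lapply x).comp s) M t) x := by
  obtain ⟨t, rfl⟩ := Submodule.Quotient.mk_surjective _ t
  induction t with
  | zero => exact ⟨∅, fun S' _ => by simp [tmk]⟩
  | tmul m n =>
    refine ⟨(s n).support, fun S' hS => ?_⟩
    have h1 (x : N) : tmk 𝕜 R (evalFormRight 𝕜 ((Finsupp.lapply x).comp s) M (tmk 𝕜 R m n)) x =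
        tmk 𝕜 R m (s n x • x) := tmk_smul 𝕜 R m (s n x) x
    change tmk 𝕜 R m n =
      ∑ x ∈ S', tmk 𝕜 R (evalFormRight 𝕜 ((Finsupp.lapply x).comp s) M (tmk 𝕜 R m n)) x
    simp only [h1]
    let L : N →+ BalTensor 𝕜 R M N := AddMonoidHom.mk' (fun n => tmk 𝕜 R m n)
      (fun a b => tmk_add_right 𝕜 R m a b)
    have h2 := hs n
    rw [Finsupp.linearCombination_apply, Finsupp.sum_of_support_subset _ hS _ (by simp)] at h2
    calc tmk 𝕜 R m n = L (∑ x ∈ S', s n x • x) := congrArg L h2.symm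
      _ = _ := map_sum L _ _
  | add a b ha hb =>
    classical
    obtain ⟨S, hS⟩ := ha
    obtain ⟨S₂, hS₂⟩ := hb
    refine ⟨S ∪ S₂, fun S' h => ?_⟩
    have e1 := hS S' (Finset.union_subset_left h)
    have e2 := hS₂ S' (Finset.union_subset_right h)
    simp only [Submodule.Quotient.mk_add, map_add, tmk_add_left, Finset.sum_add_distrib]
    rw [← e1, ← e2]

/-- Tensoring with a projective left module preserves exactness. -/
theorem exact_tensorMap_of_projective {A B C : ModuleCat.{u} Rᵐᵒᵖ} (N : ModuleCat.{u} R)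
    (hN : Module.Projective R N) {f : A ⟶ B} {g : B ⟶ C} (hex : Function.Exact f g) :
    Function.Exact (tensorMap 𝕜 R f (𝟙 N)) (tensorMap 𝕜 R g (𝟙 N)) := by
  intro t
  constructor
  · intro ht
    obtain ⟨s, hs⟩ := Module.Projective.out (R := R) (P := N)
    obtain ⟨S, hS⟩ := eq_sum_evalFormRight 𝕜 s hs B t
    -- Each coordinate of `t` is killed by `g`; preimages of the coordinates reassemble to a
    -- preimage of `t`.
    have h (x : N) : ∃ a, f a = evalFormRight 𝕜 ((Finsupp.lapply x).comp s) B t :=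
      (hex _).1 (by rw [← evalFormRight_tensorMap, ht, map_zero])
    choose a ha using h
    refine ⟨∑ x ∈ S, tmk 𝕜 R (a x) x, ?_⟩
    conv_rhs => rw [hS S subset_rfl]
    rw [map_sum]
    refine Finset.sum_congr rfl fun x _ => ?_
    rw [tensorMap_tmk, ha]
    rfl
  · rintro ⟨y, rfl⟩
    have h0 : f ≫ g = 0 := by ext x; exact hex.apply_apply_eq_zero x
    rw [tensorMap_comp_apply, h0, tensorMap_zero_left]

/-- Let `X₂ → X₁ → X₀ → G → 0` be exact with `X₀` flat, and let `0 → L → Q → E → 0` be exact.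
If `X₂ ⊗ E → X₁ ⊗ E → X₀ ⊗ E` is exact, then `G ⊗ L → G ⊗ Q` is injective. -/
theorem tensorMap_injective_of_exact {X₂ X₁ X₀ G : ModuleCat.{u} Rᵐᵒᵖ} {L Q E : ModuleCat.{u} R}
    {d : X₂ ⟶ X₁} {d' : X₁ ⟶ X₀} {p : X₀ ⟶ G} {a : L ⟶ Q} {b : Q ⟶ E}
    (hdd : d ≫ d' = 0) (hd' : Function.Exact d' p) (hp : Function.Surjective p)
    (hab : Function.Exact a b) (hb : Function.Surjective b)
    (hX₀ : Function.Injective (tensorMap 𝕜 R (𝟙 X₀) a))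
    (hE : Function.Exact (tensorMap 𝕜 R d (𝟙 E)) (tensorMap 𝕜 R d' (𝟙 E))) :
    Function.Injective (tensorMap 𝕜 R (𝟙 G) a) := by
  refine (injective_iff_map_eq_zero (tensorMap 𝕜 R (𝟙 G) a)).2 fun z hz => ?_
  obtain ⟨y, rfl⟩ := tensorMap_surjective 𝕜 hp (g := 𝟙 L) (fun x => ⟨x, rfl⟩) z
  rw [← tensorMap_comm] at hz
  obtain ⟨w, hw⟩ := (exact_tensorMap_left 𝕜 Q hd' hp _).1 hz
  -- The boundary of `w` comes from `X₀ ⊗ L`, so `w` becomes a cycle over `E`. Exactness there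
  -- permits changing `w` by a boundary until it comes from `X₁ ⊗ L`.
  have h1 : tensorMap 𝕜 R d' (𝟙 E) (tensorMap 𝕜 R (𝟙 X₁) b w) = 0 := by
    rw [tensorMap_comm, hw]
    exact (exact_tensorMap_right 𝕜 X₀ hab hb).apply_apply_eq_zero y
  obtain ⟨v, hv⟩ := (hE _).1 h1
  obtain ⟨v, rfl⟩ := tensorMap_surjective 𝕜 (f := 𝟙 X₂) (fun x => ⟨x, rfl⟩) hb v
  have h2 : tensorMap 𝕜 R (𝟙 X₁) b (w - tensorMap 𝕜 R d (𝟙 Q) v) = 0 := by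
    rw [map_sub, ← hv, tensorMap_comm, sub_self]
  obtain ⟨x, hx⟩ := (exact_tensorMap_right 𝕜 X₁ hab hb _).1 h2
  have h3 : y = tensorMap 𝕜 R d' (𝟙 L) x := by
    apply hX₀
    rw [← tensorMap_comm, hx, map_sub, hw, tensorMap_comp_apply, hdd, tensorMap_zero_left,
      sub_zero]
  rw [h3]
  exact (exact_tensorMap_left 𝕜 L hd' hp).apply_apply_eq_zero x

/-- Let `X₂ → X₁ → X₀ → G → 0` and `0 → L → Q → E → 0` be exact with `Q` projective. If
`G ⊗ L → G ⊗ Q` is injective, then `X₂ ⊗ E → X₁ ⊗ E → X₀ ⊗ E` is exact. -/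
theorem exact_tensorMap_of_injective {X₂ X₁ X₀ G : ModuleCat.{u} Rᵐᵒᵖ} {L Q E : ModuleCat.{u} R}
    {d : X₂ ⟶ X₁} {d' : X₁ ⟶ X₀} {p : X₀ ⟶ G} {a : L ⟶ Q} {b : Q ⟶ E}
    (hd : Function.Exact d d') (hd' : Function.Exact d' p) (hp : Function.Surjective p)
    (hab : Function.Exact a b) (hb : Function.Surjective b) (hQ : Module.Projective R Q)
    (hG : Function.Injective (tensorMap 𝕜 R (𝟙 G) a)) :
    Function.Exact (tensorMap 𝕜 R d (𝟙 E)) (tensorMap 𝕜 R d' (𝟙 E)) := by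
  intro x
  constructor
  · intro hx
    obtain ⟨w, rfl⟩ := tensorMap_surjective 𝕜 (f := 𝟙 X₁) (fun x => ⟨x, rfl⟩) hb x
    rw [tensorMap_comm] at hx
    obtain ⟨y, hy⟩ := (exact_tensorMap_right 𝕜 X₀ hab hb _).1 hx
    -- Injectivity over `G` forces `y` to be a boundary from `X₁ ⊗ L`. Correcting `w` accordingly
    -- gives a cycle over `Q`, which is a boundary since `Q` is projective.
    have h1 : tensorMap 𝕜 R p (𝟙 L) y = 0 := by
      apply hG
      rw [← tensorMap_comm, hy, map_zero]
      exact (exact_tensorMap_left 𝕜 Q hd' hp).apply_apply_eq_zero w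
    obtain ⟨v, rfl⟩ := (exact_tensorMap_left 𝕜 L hd' hp _).1 h1
    have h2 : tensorMap 𝕜 R d' (𝟙 Q) (w - tensorMap 𝕜 R (𝟙 X₁) a v) = 0 := by
      rw [map_sub, ← hy, tensorMap_comm, sub_self]
    obtain ⟨t, ht⟩ := (exact_tensorMap_of_projective 𝕜 Q hQ hd _).1 h2
    refine ⟨tensorMap 𝕜 R (𝟙 X₂) b t, ?_⟩
    rw [tensorMap_comm, ht, map_sub, (exact_tensorMap_right 𝕜 X₁ hab hb).apply_apply_eq_zero,
      sub_zero]
  · rintro ⟨y, rfl⟩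
    have h0 : d ≫ d' = 0 := by ext x; exact hd.apply_apply_eq_zero x
    rw [tensorMap_comp_apply, h0, tensorMap_zero_left]

end TensorExact

end

end CompleteHomology

namespace CompleteHomology

noncomputable section

/-! ### Satellites, completions and injective modules -/

section Satellites

variable {𝕜 : Type u} [CommRing 𝕜] {R : Type u} [Ring R]

instance splitMono_ι (N : ModuleCat.{u} R) [Injective N] : IsSplitMono ((ι R).app N) :=
  ⟨⟨⟨Injective.factorThru (𝟙 N) ((ι R).app N), Injective.comp_factorThru _ _⟩⟩⟩

/-- For injective `N`, the sequence `0 → N → inj N → Ω N → 0` splits. -/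
theorem exists_section_of_injective (N : ModuleCat.{u} R) [Injective N] :
    ∃ s : (Ω R).obj N ⟶ (inj R).obj N, s ≫ (injToΩ R).app N = 𝟙 _ := by
  let r := retraction ((ι R).app N)
  -- The complementary idempotent `1 - rι` kills `N`, so it descends to `Ω N` and gives the section.
  have hr : (ι R).app N ≫ (𝟙 _ - r ≫ (ι R).app N) = 0 := by
    rw [Preadditive.comp_sub, ← Category.assoc, IsSplitMono.id, Category.comp_id, Category.id_comp,
      sub_self]
  have h : cokernel.desc ((ι R).app N) (𝟙 _ - r ≫ (ι R).app N) hr ≫ cokernel.π ((ι R).app N) =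
      𝟙 _ := by
    rw [← cancel_epi (cokernel.π ((ι R).app N)), cokernel.π_desc_assoc, Preadditive.sub_comp,
      Category.assoc, cokernel.condition, comp_zero, sub_zero, Category.comp_id, Category.id_comp]
  exact ⟨_, h⟩

instance injective_Ω (N : ModuleCat.{u} R) [Injective N] : Injective ((Ω R).obj N) := by
  obtain ⟨s, hs⟩ := exists_section_of_injective N
  exact (Retract.mk s ((injToΩ R).app N) hs).injective

theorem injective_Ωpow (k : ℕ) (N : ModuleCat.{u} R) (hN : Injective N) :
    Injective ((Ωpow R k).obj N) := by
  induction k with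
  | zero => exact hN
  | succ k ih => exact injective_Ω ((Ωpow R k).obj N)

/-- Positive satellites of any functor vanish on injective modules. -/
theorem satellite_succ_isZero (F : ModuleCat.{u} R ⥤ ModuleCat.{u} 𝕜) (k : ℕ)
    (E : ModuleCat.{u} R) (hE : Injective E) : IsZero ((satellite F (k + 1)).obj E) := by
  have := injective_Ωpow k E hE
  obtain ⟨s, hs⟩ := exists_section_of_injective ((Ωpow R k).obj E)
  let α := Functor.whiskerRight (Functor.whiskerLeft (Ωpow R k) (injToΩ R)) F
  have h1 : α.app E ≫ (cokernel.π α).app E = 0 := by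
    rw [← NatTrans.comp_app, cokernel.condition]
    rfl
  -- Any functor preserves split epimorphisms, so the map whose cokernel is the satellite is split
  -- epi at `E`. No additivity of `F` is needed.
  have h2 : F.map s ≫ α.app E = 𝟙 _ := by
    change F.map s ≫ F.map ((injToΩ R).app ((Ωpow R k).obj E)) = _
    rw [← F.map_comp, hs, F.map_id]
  have h3 : (cokernel.π α).app E = 0 := by
    refine (Category.id_comp ((cokernel.π α).app E)).symm.trans ?_
    refine (congrArg (· ≫ (cokernel.π α).app E) h2).symm.trans ?_
    exact (Category.assoc _ _ _).trans ((congrArg (F.map s ≫ ·) h1).trans comp_zero)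
  have h4 : Epi (cokernel.π α) := inferInstance
  exact @IsZero.of_epi_eq_zero _ _ _ _ _ _ ((NatTrans.epi_iff_epi_app (cokernel.π α)).1 h4 E) h3

/-- The injective completion of a homological functor vanishes on injective modules. -/
theorem completion_isZero (H : HomologicalFunctor.{u} 𝕜 R) (i : ℤ) (E : ModuleCat.{u} R)
    (hE : Injective E) : IsZero ((H.completion i).obj E) := by
  let D := Functor.ofOpSequence (X := fun k : ℕ => satellite (H.T (k + i)) k)
    (fun k => H.transition k (((k + 1 : ℕ) : ℤ) + i) (k + i) (by push_cast; ring))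
  have hc : IsLimit (((evaluation _ _).obj E).mapCone (limit.cone D)) :=
    isLimitOfPreserves _ (limit.isLimit D)
  refine (IsZero.iff_id_eq_zero _).2 (hc.hom_ext fun j => ?_)
  obtain ⟨k⟩ := j
  let c := ((evaluation _ _).obj E).mapCone (limit.cone D)
  -- Each projection factors through the next stage, a positive satellite. This also disposes of
  -- stage `0`, which need not vanish itself.
  have hw : c.π.app (Opposite.op (k + 1)) ≫ _ = c.π.app (Opposite.op k) :=
    c.w (homOfLE (Nat.le_add_right k 1)).op
  have h0 : c.π.app (Opposite.op (k + 1)) = 0 :=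
    (satellite_succ_isZero (H.T (((k + 1 : ℕ) : ℤ) + i)) k E hE).eq_of_tgt _ _
  change 𝟙 c.pt ≫ c.π.app (Opposite.op k) = 0 ≫ c.π.app (Opposite.op k)
  rw [← hw, h0]
  simp

/-- The map whose cokernel defines a positive satellite has source `F (inj _) = 0`, so nothing is
divided out. -/
theorem isIso_satelliteProj (F : ModuleCat.{u} R ⥤ ModuleCat.{u} 𝕜)
    (hF : ∀ E, Injective E → IsZero (F.obj E)) (k : ℕ) : IsIso (satelliteProj F k) := by
  cases k with
  | zero => exact inferInstanceAs (IsIso (Functor.leftUnitor F).hom)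
  | succ k =>
    have h0 : Functor.whiskerRight (Functor.whiskerLeft (Ωpow R k) (injToΩ R)) F = 0 := by
      ext N : 2
      exact (hF _ (injective_inj R _)).eq_of_src _ _
    have h (X Y : ModuleCat.{u} R ⥤ ModuleCat.{u} 𝕜) (f : X ⟶ Y) (hf : f = 0) :
        IsIso (cokernel.π f) := by
      subst hf
      infer_instance
    exact h _ _ _ h0

variable (H : HomologicalFunctor.{u} 𝕜 R)

/-- In the long exact sequence of `0 → Ωᵏ N → inj (Ωᵏ N) → Ωᵏ⁺¹ N → 0`, both terms flanking the
connecting map are values at an injective module. -/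
theorem isIso_connecting (k : ℕ) (i j : ℤ) (hij : j + 1 = i)
    (hi : ∀ E, Injective E → IsZero ((H.T i).obj E))
    (hj : ∀ E, Injective E → IsZero ((H.T j).obj E)) : IsIso (H.connecting k i j hij) := by
  rw [NatTrans.isIso_iff_isIso_app]
  intro N
  have hS := cosyzygySeq_shortExact R ((Ωpow R k).obj N)
  have h1 := ModuleCat.subsingleton_of_isZero (hi _ (injective_inj R ((Ωpow R k).obj N)))
  have h2 := ModuleCat.subsingleton_of_isZero (hj _ (injective_inj R ((Ωpow R k).obj N)))
  change IsIso (H.δ hS i j hij)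
  rw [ConcreteCategory.isIso_iff_bijective]
  constructor
  · refine (injective_iff_map_eq_zero (H.δ hS i j hij).hom).2 fun x hx => ?_
    obtain ⟨y, rfl⟩ := (H.exact₃ hS i j hij x).1 hx
    exact (congrArg _ (h1.elim y 0)).trans (map_zero ((H.T i).map _).hom)
  · intro x
    exact (H.exact₁ hS i j hij x).1 (h2.elim _ _)

theorem isIso_transition (k : ℕ) (i j : ℤ) (hij : j + 1 = i)
    (hi : ∀ E, Injective E → IsZero ((H.T i).obj E))
    (hj : ∀ E, Injective E → IsZero ((H.T j).obj E)) : IsIso (H.transition k i j hij) := by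
  have h1 := isIso_satelliteProj (H.T i) hi (k + 1)
  have h2 := isIso_satelliteProj (H.T j) hj k
  have h3 := isIso_connecting H k i j hij hi hj
  have h : satelliteProj (H.T i) (k + 1) ≫ H.transition k i j hij =
      H.connecting k i j hij ≫ satelliteProj (H.T j) k := cokernel.π_desc _ _ _
  have h4 : IsIso (satelliteProj (H.T i) (k + 1) ≫ H.transition k i j hij) := by
    rw [h]
    exact IsIso.comp_isIso' h3 h2
  exact IsIso.of_isIso_comp_left (satelliteProj (H.T i) (k + 1)) _

theorem isEventuallyConstantTo_ofOpSequence {C : Type*} [Category* C] {X : ℕ → C}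
    (f : ∀ n, X (n + 1) ⟶ X n) (k : ℕ) (hf : ∀ n ≥ k, IsIso (f n)) :
    (Functor.ofOpSequence f).IsEventuallyConstantTo (Opposite.op k) := by
  have key (m : ℕ) : ∀ h : k ≤ k + m, IsIso ((Functor.ofOpSequence f).map (homOfLE h).op) := by
    induction m with
    | zero =>
      intro h
      rw [Subsingleton.elim (homOfLE h).op (𝟙 _)]
      infer_instance
    | succ m ih =>
      intro h
      have h1 := ih (Nat.le_add_right k m)
      have h2 := hf (k + m) (Nat.le_add_right k m)
      have e : (homOfLE h).op = (homOfLE (Nat.le_add_right (k + m) 1)).op ≫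
        (homOfLE (Nat.le_add_right k m)).op := Subsingleton.elim _ _
      rw [e, Functor.map_comp, Functor.ofOpSequence_map_homOfLE_succ]
      exact IsIso.comp_isIso' h2 h1
  rintro ⟨n⟩ φ
  obtain ⟨m, rfl⟩ := Nat.exists_eq_add_of_le (leOfHom φ.unop)
  exact key m _

/-- If `H` vanishes on injective modules in all degrees `≥ k + i`, then the inverse system that
defines the completion is constant from `k` on. -/
theorem nonempty_completionIso (i : ℤ) (k : ℕ)
    (h : ∀ j : ℤ, k + i ≤ j → ∀ E, Injective E → IsZero ((H.T j).obj E)) :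
    Nonempty (H.completion i ≅ Ωpow R k ⋙ H.T (k + i)) := by
  have hc := isEventuallyConstantTo_ofOpSequence (X := fun k : ℕ => satellite (H.T (k + i)) k)
    (fun k => H.transition k (((k + 1 : ℕ) : ℤ) + i) (k + i) (by push_cast; ring)) k
    (fun n hn => isIso_transition H n _ _ _ (h _ (by push_cast; omega)) (h _ (by omega)))
  have h1 := hc.isIso_π_of_isLimit (limit.isLimit _)
  have h2 := isIso_satelliteProj (H.T (k + i)) (h _ le_rfl) k
  exact ⟨@asIso _ _ _ _ _ h1 ≪≫ (asIso (satelliteProj (H.T (k + i)) k)).symm⟩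

/-- Dimension shifting for a homological functor that vanishes on injective modules. -/
theorem nonempty_ΩpowIso (h : ∀ (j : ℤ) E, Injective E → IsZero ((H.T j).obj E)) (i : ℤ) (k : ℕ) :
    Nonempty (Ωpow R k ⋙ H.T (k + i) ≅ H.T i) := by
  induction k with
  | zero =>
    rw [Nat.cast_zero, zero_add]
    exact ⟨Functor.leftUnitor _⟩
  | succ k ih =>
    obtain ⟨e⟩ := ih
    have := isIso_connecting H k (((k + 1 : ℕ) : ℤ) + i) (k + i) (by push_cast; ring) (h _) (h _)
    exact ⟨@asIso _ _ _ _ _ this ≪≫ e⟩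

end Satellites

end

end CompleteHomology

namespace CompleteHomology

noncomputable section

/-! ### Shifts of complexes and their Gorenstein projective cokernels -/

section Complexes

variable {R : Type u} [Ring R]

/-- The three degrees are free variables tied by equations, so that shifted degrees need no
transport. -/
theorem exactAt_iff_of_eq {A : Type u} [Ring A] (K : ChainComplex (ModuleCat.{u} A) ℤ)
    (i j k : ℤ) (hij : j + 1 = i) (hjk : k + 1 = j) :
    K.ExactAt j ↔ Function.Exact (K.d i j) (K.d j k) :=
  (K.exactAt_iff' i j k (ComplexShape.prev_eq' _ hij) (ComplexShape.next_eq' _ hjk)).trans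
    (ShortComplex.ShortExact.moduleCat_exact_iff_function_exact _)

theorem acyclic_of_exact {A : Type u} [Ring A] (K : ChainComplex (ModuleCat.{u} A) ℤ)
    (h : ∀ n : ℤ, Function.Exact (K.d (n + 1 + 1) (n + 1)) (K.d (n + 1) n)) : K.Acyclic := by
  intro j
  rw [exactAt_iff_of_eq K (j - 1 + 1 + 1) j (j - 1) (by ring) (by ring)]
  have := h (j - 1)
  rwa [sub_add_cancel j 1] at this ⊢

/-- The translation of degrees by `n`. -/
def addEmbedding (n : ℤ) : (ComplexShape.down ℤ).Embedding (ComplexShape.down ℤ) :=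
  ComplexShape.Embedding.mk' _ _ (fun i => i + n) (fun _ _ h => by simpa using h)
    (by intro i j; simp only [ComplexShape.down_Rel]; omega)

instance (n : ℤ) : (addEmbedding n).IsRelIff  where
  rel' i j h := by
    have h : j + n + 1 = i + n := h
    change j + 1 = i
    omega

theorem acyclic_restriction {A : Type u} [Ring A] (K : ChainComplex (ModuleCat.{u} A) ℤ)
    (hK : K.Acyclic) (n : ℤ) : (K.restriction (addEmbedding n)).Acyclic :=
  acyclic_of_exact _ fun j =>
    (exactAt_iff_of_eq K (j + 1 + 1 + n) (j + 1 + n) (j + n) (by ring) (by ring)).1 (hK _)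

theorem isTotallyAcyclic_restriction {T : ChainComplex (ModuleCat.{u} Rᵐᵒᵖ) ℤ}
    (hT : IsTotallyAcyclic T) (n : ℤ) :
    IsTotallyAcyclic (T.restriction (addEmbedding n)) where
  projective i := hT.projective (i + n)
  acyclic := acyclic_restriction T hT.acyclic n
  hom_acyclic P hP j := by
    -- `Hom (T, P)` is graded by the opposite shape, so its differential raises degrees.
    rw [HomologicalComplex.exactAt_iff' _ (j - 1) j (j + 1)
      (ComplexShape.prev_eq' _ (by simp)) (ComplexShape.next_eq' _ (by simp))]
    exact (HomologicalComplex.exactAt_iff' _ (j - 1 + n) (j + n) (j + 1 + n)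
      (ComplexShape.prev_eq' _ (by simp; ring)) (ComplexShape.next_eq' _ (by simp; ring))).1
      (hT.hom_acyclic P hP (j + n))

/-- Translating `T` brings any cokernel into degree `0`, so every syzygy of `T` is Gorenstein
projective. -/
theorem isGorensteinProjective_cokernel {T : ChainComplex (ModuleCat.{u} Rᵐᵒᵖ) ℤ}
    (hT : IsTotallyAcyclic T) (j k : ℤ) (hjk : k + 1 = j) :
    IsGorensteinProjective (cokernel (T.d j k)) := by
  have h (j' k' : ℤ) (hj : j = j') (hk : k = k') :
      Nonempty (cokernel (T.d j' k') ≅ cokernel (T.d j k)) := by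
    subst hj hk
    exact ⟨Iso.refl _⟩
  exact ⟨_, isTotallyAcyclic_restriction hT k, h (1 + k) (0 + k) (by omega) (by omega)⟩

theorem exact_cokernel_π {A : Type u} [Ring A] {X Y : ModuleCat.{u} A} (f : X ⟶ Y) :
    Function.Exact f (cokernel.π f) :=
  (ShortComplex.ShortExact.moduleCat_exact_iff_function_exact _).1 (ShortComplex.exact_cokernel f)

theorem cokernel_π_surjective {A : Type u} [Ring A] {X Y : ModuleCat.{u} A} (f : X ⟶ Y) :
    Function.Surjective (cokernel.π f) :=
  (ModuleCat.epi_iff_surjective _).1 inferInstance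

/-! ### Tensoring with injectives; Tate homology versus `Tor` -/

variable (𝕜 : Type u) [CommRing 𝕜] [Algebra 𝕜 R]

theorem tensorComplex_exactAt_iff (X : ChainComplex (ModuleCat.{u} Rᵐᵒᵖ) ℤ) (E : ModuleCat.{u} R)
    (i j k : ℤ) (hij : j + 1 = i) (hjk : k + 1 = j) :
    ((tensorComplex 𝕜 R X).obj E).ExactAt j ↔
      Function.Exact (tensorMap 𝕜 R (X.d i j) (𝟙 E)) (tensorMap 𝕜 R (X.d j k) (𝟙 E)) :=
  exactAt_iff_of_eq _ i j k hij hjk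

/-- A module is a quotient of a projective module. -/
theorem exists_projective_presentation (E : ModuleCat.{u} R) :
    ∃ (L Q : ModuleCat.{u} R) (a : L ⟶ Q) (b : Q ⟶ E), Mono a ∧ Module.Projective R Q ∧
      Function.Exact a b ∧ Function.Surjective b := by
  refine ⟨_, _, kernel.ι (Projective.π E), Projective.π E, inferInstance, ?_, ?_, ?_⟩
  · exact (IsProjective.iff_projective (R := R) (Projective.over E : ModuleCat.{u} R)).2 (Projective.projective_over E)
  · exact (ShortComplex.ShortExact.moduleCat_exact_iff_function_exact _).1
      (ShortComplex.exact_kernel (Projective.π E))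
  · exact (ModuleCat.epi_iff_surjective _).1 inferInstance

/-- If `T` is an acyclic complex whose cokernel in degree `k` is Gorenstein flat, then `T ⊗_R E` is
exact in degree `k + 1` for every injective module `E`. -/
theorem tensorComplex_exactAt_of_isGorensteinFlat {T : ChainComplex (ModuleCat.{u} Rᵐᵒᵖ) ℤ}
    (hT : T.Acyclic) (i j k : ℤ) (hij : j + 1 = i) (hjk : k + 1 = j)
    (hG : IsGorensteinFlat 𝕜 (cokernel (T.d j k))) (E : ModuleCat.{u} R) (hE : Injective E) :
    ((tensorComplex 𝕜 R T).obj E).ExactAt j := by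
  obtain ⟨F, hF, hFa, hFE, ⟨e⟩⟩ := hG
  obtain ⟨L, Q, a, b, ha, hQ, hab, hb⟩ := exists_projective_presentation E
  -- This injectivity involves only the cokernel `G`: it is proved with the flat complex `F`, where
  -- it uses `H₁ (F ⊗ E) = 0`, and then applied to `T`.
  have hinj : Function.Injective (tensorMap 𝕜 R (𝟙 (cokernel (T.d j k))) a) := by
    refine tensorMap_injective_of_exact 𝕜 (F.d_comp_d 2 1 0) (p := cokernel.π (F.d 1 0) ≫ e.hom)
      ?_ ?_ hab hb ((ModuleCat.mono_iff_injective _).1 (hF 0 a ha))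
      ((tensorComplex_exactAt_iff 𝕜 F E 2 1 0 (by norm_num) (by norm_num)).1 (hFE E hE 1))
    · intro x
      rw [← exact_cokernel_π (F.d 1 0) x, ModuleCat.comp_apply]
      exact map_eq_zero_iff e.hom.hom ((ModuleCat.mono_iff_injective e.hom).1 inferInstance)
    · exact (ModuleCat.epi_iff_surjective _).1 inferInstance
  rw [tensorComplex_exactAt_iff 𝕜 T E i j k hij hjk]
  exact exact_tensorMap_of_injective 𝕜 ((exactAt_iff_of_eq T i j k hij hjk).1 (hT j))
    (exact_cokernel_π _) (cokernel_π_surjective _) hab hb hQ hinj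

/-- Exactness in degree `j` is governed by the cokernel of `T_j → T_{j-1}`, which is Gorenstein
projective for every `j`. -/
theorem tensorComplex_acyclic_of_isTotallyAcyclic
    (h : ∀ G : ModuleCat.{u} Rᵐᵒᵖ, IsGorensteinProjective G → IsGorensteinFlat 𝕜 G)
    {T : ChainComplex (ModuleCat.{u} Rᵐᵒᵖ) ℤ} (hT : IsTotallyAcyclic T) (E : ModuleCat.{u} R)
    (hE : Injective E) : ((tensorComplex 𝕜 R T).obj E).Acyclic := fun j =>
  tensorComplex_exactAt_of_isGorensteinFlat 𝕜 hT.acyclic (j + 1) j (j - 1) rfl (by ring)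
    (h _ (isGorensteinProjective_cokernel hT j (j - 1) (by ring))) E hE

/-- The natural transformation `X ⊗_R - ⟶ Y ⊗_R -` induced by a map of complexes. -/
def tensorComplexMap {X Y : ChainComplex (ModuleCat.{u} Rᵐᵒᵖ) ℤ} (f : X ⟶ Y) :
    tensorComplex 𝕜 R X ⟶ tensorComplex 𝕜 R Y where
  app N := (((tensor 𝕜 R).flip.obj N).mapHomologicalComplex _).map f
  naturality _ _ g :=
    ((NatTrans.mapHomologicalComplex ((tensor 𝕜 R).flip.map g) _).naturality f).symm

theorem isIso_homologyMap_of_isIso {A : Type u} [Ring A] {K L : ChainComplex (ModuleCat.{u} A) ℤ}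
    (f : K ⟶ L) (j : ℤ) (h₁ : IsIso (f.f (j + 1))) (h₂ : IsIso (f.f j))
    (h₃ : IsIso (f.f (j - 1))) : IsIso (HomologicalComplex.homologyMap f j) := by
  have h₁' : IsIso (f.f ((ComplexShape.down ℤ).prev j)) := by
    rwa [show (ComplexShape.down ℤ).prev j = j + 1 from ComplexShape.prev_eq' _ (by simp)]
  have h₃' : IsIso (f.f ((ComplexShape.down ℤ).next j)) := by
    rwa [show (ComplexShape.down ℤ).next j = j - 1 from ComplexShape.next_eq' _ (by simp)]
  let φ := (HomologicalComplex.shortComplexFunctor _ _ j).map f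
  have : IsIso φ := by
    have : IsIso φ.τ₁ := h₁'
    have : IsIso φ.τ₂ := h₂
    have : IsIso φ.τ₃ := h₃'
    exact ShortComplex.isIso_of_isIso φ
  exact inferInstanceAs (IsIso ((ShortComplex.homologyFunctor _).map φ))

instance : natEmbedding.IsRelIff where
  rel' i j h := by
    have h : (j : ℤ) + 1 = i := h
    change j + 1 = i
    omega

instance : natEmbedding.IsTruncLE where
  mem_prev {i j} h := by
    have h : (j : ℤ) + 1 = i := h
    exact ⟨j + 1, (Nat.cast_succ j).trans h⟩

/-- A homotopy equivalence extends along an embedding of complex shapes. -/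
def extendHomotopyEquiv {V : Type*} [Category* V] [Preadditive V] [HasZeroObject V]
    {I J : Type*} {c : ComplexShape I} {c' : ComplexShape J} {K L : HomologicalComplex V c}
    (h : HomotopyEquiv K L) (e : c.Embedding c') [e.IsRelIff] :
    HomotopyEquiv (K.extend e) (L.extend e) where
  hom := HomologicalComplex.extendMap h.hom e
  inv := HomologicalComplex.extendMap h.inv e
  homotopyHomInvId := ((Homotopy.ofEq (HomologicalComplex.extendMap_comp _ _ _).symm).trans
    (h.homotopyHomInvId.extend e)).trans (Homotopy.ofEq (HomologicalComplex.extendMap_id _ _))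
  homotopyInvHomId := ((Homotopy.ofEq (HomologicalComplex.extendMap_comp _ _ _).symm).trans
    (h.homotopyInvHomId.extend e)).trans (Homotopy.ofEq (HomologicalComplex.extendMap_id _ _))

/-- In sufficiently high degrees, Tate homology is `Tor`. -/
theorem exists_nonempty_TorIso {M : ModuleCat.{u} Rᵐᵒᵖ} (C : CompleteProjectiveResolution M) :
    ∃ n : ℤ, ∀ j ≥ n, Nonempty ((Tor 𝕜 M).T j ≅ C.tateTor 𝕜 j) := by
  obtain ⟨n, hn⟩ := C.isIso_ϖ
  -- Homology in degree `j` also involves degree `j - 1`, hence the bound `n + 1`.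
  refine ⟨n + 1, fun j hj => ?_⟩
  let H := HomologicalComplex.homologyFunctor (ModuleCat.{u} 𝕜) (ComplexShape.down ℤ) j
  have h1 : IsIso (Functor.whiskerRight (tensorComplexMap 𝕜 C.ϖ) H) := by
    rw [NatTrans.isIso_iff_isIso_app]
    intro N
    have key (i : ℤ) (hi : n ≤ i) : IsIso (((tensorComplexMap 𝕜 C.ϖ).app N).f i) := by
      have := hn i hi
      exact inferInstanceAs (IsIso (((tensor 𝕜 R).flip.obj N).map (C.ϖ.f i)))
    exact isIso_homologyMap_of_isIso _ j (key _ (by omega)) (key _ (by omega)) (key _ (by omega))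
  -- `Tor` is computed from a chosen resolution, in general not `C.P`; the two are homotopy
  -- equivalent, and additive functors preserve this.
  let h := C.P.homotopyEquiv (projectiveResolution M)
  have h2 : IsIso (Functor.whiskerRight
      (tensorComplexMap 𝕜 (HomologicalComplex.extendMap h.hom natEmbedding)) H) := by
    rw [NatTrans.isIso_iff_isIso_app]
    intro N
    exact (((tensor 𝕜 R).flip.obj N).mapHomotopyEquiv
      (extendHomotopyEquiv h natEmbedding)).toHomologyIso j |>.isIso_hom
  exact ⟨(asIso (Functor.whiskerRight (tensorComplexMap 𝕜 C.ϖ) H) ≪≫ @asIso _ _ _ _ _ h2).symm⟩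

end Complexes

end

end CompleteHomology

namespace CompleteHomology

noncomputable section

/-! ### Complete resolutions from totally acyclic complexes -/

section Resolutions

variable {R : Type u} [Ring R]

/-- The projective resolution of `Coker (T₁ → T₀)` given by the nonnegative part of an acyclic
complex `T` of projective modules. -/
def truncatedResolution (T : ChainComplex (ModuleCat.{u} Rᵐᵒᵖ) ℤ)
    (hT : ∀ n, Projective (T.X n)) (hT' : T.Acyclic) :
    ProjectiveResolution (cokernel (T.d 1 0)) where
  complex := T.restriction natEmbedding
  projective n := hT n
  π := (ChainComplex.toSingle₀Equiv _ _).symm ⟨cokernel.π (T.d 1 0), cokernel.condition _⟩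
  quasiIso := ⟨fun n => by
    cases n with
    | zero =>
      -- In degree `0` the condition is right exactness of `T₁ → T₀ → Coker`; in positive degrees it
      -- is acyclicity of `T`.
      rw [ChainComplex.quasiIsoAt₀_iff, ShortComplex.quasiIso_iff_of_zeros' _
        (T.shape 0 0 (by simp)) rfl rfl]
      refine (ShortComplex.exact_and_epi_g_iff_of_iso ?_).2
        ⟨ShortComplex.exact_cokernel (T.d 1 0), by dsimp; infer_instance⟩
      exact ShortComplex.isoMk (Iso.refl _) (Iso.refl _) (Iso.refl _)
        (by simp; rfl)
        ((Category.id_comp _).trans (Eq.trans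
          (ChainComplex.toSingle₀Equiv_symm_apply_f_zero (C := T.restriction natEmbedding)
            (cokernel.π (T.d 1 0)) (cokernel.condition _)).symm (Category.comp_id _).symm))
    | succ n =>
      rw [quasiIsoAt_iff_exactAt' _ _ (ChainComplex.exactAt_succ_single_obj _ _),
        HomologicalComplex.exactAt_iff' _ (n + 1 + 1) (n + 1) n (by simp) (by simp)]
      exact (ShortComplex.ShortExact.moduleCat_exact_iff_function_exact _).2
        ((exactAt_iff_of_eq T ((n + 1 + 1 : ℕ) : ℤ) ((n + 1 : ℕ) : ℤ) (n : ℤ)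
          (by push_cast; ring) (by push_cast; ring)).1 (hT' _))⟩

/-- A totally acyclic complex `T` is part of a complete projective resolution of
`Coker (T₁ → T₀)`. -/
def IsTotallyAcyclic.completeResolution {T : ChainComplex (ModuleCat.{u} Rᵐᵒᵖ) ℤ}
    (hT : IsTotallyAcyclic T) : CompleteProjectiveResolution (cokernel (T.d 1 0)) where
  T := T
  totallyAcyclic := hT
  P := truncatedResolution T hT.projective hT.acyclic
  -- `ϖ` is the identity in nonnegative degrees and zero below. It is a chain map because no
  -- differential enters a nonnegative degree from a negative one.
  ϖ := natEmbedding.liftExtend (𝟙 (T.restriction natEmbedding))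
    fun _ hj _ _ => hj.false_of_isTruncLE.elim
  isIso_ϖ := ⟨0, fun i hi => by
    obtain ⟨n, rfl⟩ := Int.eq_ofNat_of_zero_le hi
    have h := natEmbedding.isIso_liftExtend_f_iff (𝟙 (T.restriction natEmbedding))
      (fun _ hj _ _ => hj.false_of_isTruncLE.elim) (i := n) (i' := n) rfl
    exact h.2 inferInstance⟩

end Resolutions

end

end CompleteHomology

/-- Complete homology agrees with Tate homology for all right modules that have a complete
projective resolution if and only if all Gorenstein projective right modules are Gorenstein
flat. -/
theorem mainTheorem4 (𝕜 : Type u) [CommRing 𝕜] (R : Type u) [Ring R] [Algebra 𝕜 R] :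
    (∀ G : ModuleCat.{u} Rᵐᵒᵖ, CompleteHomology.IsGorensteinProjective G →
      CompleteHomology.IsGorensteinFlat 𝕜 G) ↔
    (∀ (M : ModuleCat.{u} Rᵐᵒᵖ) (C : CompleteHomology.CompleteProjectiveResolution M) (i : ℤ),
      Nonempty (CompleteHomology.completeTor 𝕜 M i ≅ C.tateTor 𝕜 i)) := by
  open CompleteHomology in
  constructor
  · intro h M C i
    have hT (j : ℤ) (E : ModuleCat.{u} R) (hE : Injective E) : IsZero ((C.tateTor 𝕜 j).obj E) :=
      (tensorComplex_acyclic_of_isTotallyAcyclic 𝕜 h C.totallyAcyclic E hE j).isZero_homology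
    obtain ⟨n, hn⟩ := exists_nonempty_TorIso 𝕜 C
    -- From stage `k` on, only degrees where `Tor` is Tate homology occur. The comparison is used as
    -- an isomorphism at this single stage, so its compatibility with connecting maps is not needed.
    obtain ⟨k, hk⟩ : ∃ k : ℕ, n ≤ k + i := ⟨(n - i).toNat, by omega⟩
    obtain ⟨e₁⟩ := nonempty_completionIso (Tor 𝕜 M) i k fun j hj E hE =>
      (hT j E hE).of_iso ((hn j (hk.trans hj)).some.app E)
    obtain ⟨e₂⟩ := hn (k + i) hk
    obtain ⟨e₃⟩ := nonempty_ΩpowIso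
      (homologyOfTensor 𝕜 C.T C.totallyAcyclic.projective) hT i k
    exact ⟨e₁ ≪≫ Functor.isoWhiskerLeft _ e₂ ≪≫ e₃⟩
  · rintro h G ⟨T, hT, ⟨e⟩⟩
    refine ⟨T, fun n => isFlat_of_projective 𝕜 _ (hT.projective n), hT.acyclic,
      fun E hE i => ?_, ⟨e⟩⟩
    -- The complete resolution has `T` as its totally acyclic complex, so its Tate homology at `E`
    -- is `H_i (T ⊗ E)`, while the complete homology at `E` is zero.
    obtain ⟨e'⟩ := h _ hT.completeResolution i
    rw [HomologicalComplex.exactAt_iff_isZero_homology]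
    exact (completion_isZero _ i E hE).of_iso (e'.symm.app E)
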